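/- Let $K$ be a field of characteristic $0$. Let $\mathcal{LT}$ be the free nonsymmetric operad (in $\mathbb{Z}$-graded $K$-vector spaces, with Koszul signs) generated by one ternary operation $t$ of odd homological degree. Its underlying vector space has as basis the set of ternary trees (rooted plane trees in which every node has either no children or exactly three), and the weight of a tree is its number of internal nodes. Let $\alpha = t\circ_1 t + t\circ_2 t + t\circ_3 t$, let $\langle\alpha\rangle$ be the operad ideal generated by $\alpha$, and let $\mathcal{LT}/\langle\alpha\rangle$ be the ternary partially associative operad with an odd generator. Then for every $w \ge 0$: (1) the weight-$w$ component of $\mathcal{LT}/\langle\alpha\rangle$ has dimension equal to the Catalan number $$C_w=\frac{1}{w+1}\binom{2w}{w},$$ the number of plane binary trees with $w$ internal nodes; (2) the normal monomials of weight $w$ are exactly the ternary trees of weight $w$ in which no internal node is the left child of its parent. Here the path sequence of a tree lists the distances from the root to the leaves, from left to right; trees with the same number of leaves are ordered by lexicographic comparison of their path sequences; and a tree is a normal monomial if it is not the greatest tree occurring in any nonzero homogeneous (single-arity) element of $\langle\alpha\rangle$. -/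

import Mathlib

/-- Ternary trees: rooted plane trees in which every node has no children (a leaf) or exactly three
children (an internal node). -/
inductive TernaryTree : Type
  | leaf : TernaryTree
  | node (l m r : TernaryTree) : TernaryTree

namespace TernaryTree

/-- The weight: the number of internal nodes. -/
def weight : TernaryTree → ℕ
  | leaf => 0
  | node l m r => l.weight + m.weight + r.weight + 1

/-- The arity: the number of leaves. -/
def arity : TernaryTree → ℕ
  | leaf => 1
  | node l m r => l.arity + m.arity + r.arity

/-- The basic tree `t` of weight one. -/
def basic : TernaryTree := node leaf leaf leaf

/-- `graft p i q` identifies leaf `i` of `p` with the root of `q`. Leaves are numbered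
`1, …, p.arity` from left to right; only indices in this range are ever used. -/
def graft : TernaryTree → ℕ → TernaryTree → TernaryTree
  | leaf, _, q => q
  | node l m r, i, q =>
      if i ≤ l.arity then node (l.graft i q) m r
      else if i ≤ l.arity + m.arity then node l (m.graft (i - l.arity) q) r
      else node l m (r.graft (i - (l.arity + m.arity)) q)

/-- The number of internal nodes of `p` that come after leaf `i` when the tree is read in planar
preorder (root first, then the three subtrees from left to right). -/
def nodesAfter : TernaryTree → ℕ → ℕ
  | leaf, _ => 0
  | node l m r, i =>
      if i ≤ l.arity then l.nodesAfter i + m.weight + r.weight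
      else if i ≤ l.arity + m.arity then m.nodesAfter (i - l.arity) + r.weight
      else r.nodesAfter (i - (l.arity + m.arity))

/-- The path sequence: the distances from the root to the leaves, from left to right. -/
def pathSeq : TernaryTree → List ℕ
  | leaf => [0]
  | node l m r => (l.pathSeq ++ m.pathSeq ++ r.pathSeq).map (· + 1)

/-- No internal node of the tree is the left child of its parent. -/
def NoLeftInternal : TernaryTree → Prop
  | leaf => True
  | node l m r => l = leaf ∧ m.NoLeftInternal ∧ r.NoLeftInternal

/-- A ternary tree of weight `w` has `2 * w + 1` leaves, so that the grading by arity and the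
grading by weight carry the same information. -/
theorem arity_eq (p : TernaryTree) : p.arity = 2 * p.weight + 1 := by
  induction p with
  | leaf => rfl
  | node l m r hl hm hr => simp only [arity, weight]; omega

theorem weight_graft (p : TernaryTree) (i : ℕ) (q : TernaryTree) :
    (p.graft i q).weight = p.weight + q.weight := by
  induction p generalizing i with
  | leaf => simp [graft, weight]
  | node l m r hl hm hr =>
    simp only [graft]
    split_ifs <;> simp only [weight, hl, hm, hr] <;> omega

theorem arity_graft (p : TernaryTree) (i : ℕ) (q : TernaryTree) :
    (p.graft i q).arity + 1 = p.arity + q.arity := by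
  simp only [arity_eq, weight_graft]; omega

/-- Composition inside the grafted tree. -/
theorem graft_graft_inner (p q r : TernaryTree) (i j : ℕ) (hi : 1 ≤ i) (hp : i ≤ p.arity)
    (hij : i ≤ j) (hj : j < i + q.arity) :
    (p.graft i q).graft j r = p.graft i (q.graft (j + 1 - i) r) ∧
      (p.graft i q).nodesAfter j = q.nodesAfter (j + 1 - i) + p.nodesAfter i := by
  induction p generalizing i j with
  | leaf =>
    obtain rfl : i = 1 := by simp only [arity] at hp; omega
    simp [graft, nodesAfter]
  | node a b c ha hb hc =>
    simp only [arity] at hp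
    by_cases h1 : i ≤ a.arity
    · have h := arity_graft a i q
      have k : j ≤ (a.graft i q).arity := by omega
      obtain ⟨e1, e2⟩ := ha i j hi h1 hij hj
      simp only [graft, nodesAfter, h1, k, if_true, e1, e2]
      exact ⟨trivial, by omega⟩
    by_cases h2 : i ≤ a.arity + b.arity
    · have h := arity_graft b (i - a.arity) q
      have k1 : ¬ j ≤ a.arity := by omega
      have k2 : j ≤ a.arity + (b.graft (i - a.arity) q).arity := by omega
      obtain ⟨e1, e2⟩ := hb (i - a.arity) (j - a.arity) (by omega) (by omega) (by omega) (by omega)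
      rw [show j - a.arity + 1 - (i - a.arity) = j + 1 - i by omega] at e1 e2
      simp only [graft, nodesAfter, h1, h2, k1, k2, if_true, if_false, e1, e2]
      exact ⟨trivial, by omega⟩
    · have k1 : ¬ j ≤ a.arity := by omega
      have k2 : ¬ j ≤ a.arity + b.arity := by omega
      obtain ⟨e1, e2⟩ := hc (i - (a.arity + b.arity)) (j - (a.arity + b.arity)) (by omega)
        (by omega) (by omega) (by omega)
      rw [show j - (a.arity + b.arity) + 1 - (i - (a.arity + b.arity)) = j + 1 - i by omega]
        at e1 e2
      simp only [graft, nodesAfter, h1, h2, k1, k2, if_false, e1, e2, and_self]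

/-- Composition at two different leaves. -/
theorem graft_graft_parallel (p q r : TernaryTree) (i j : ℕ) (hj : 1 ≤ j) (hji : j < i)
    (hp : i ≤ p.arity) :
    (p.graft i q).graft j r = (p.graft j r).graft (i + r.arity - 1) q ∧
      (p.graft i q).nodesAfter j = p.nodesAfter j + q.weight ∧
      (p.graft j r).nodesAfter (i + r.arity - 1) = p.nodesAfter i := by
  have hr := arity_eq r
  induction p generalizing i j with
  | leaf => simp only [arity] at hp; omega
  | node a b c ha hb hc =>
    simp only [arity] at hp
    have A := arity_graft a
    have B := arity_graft b
    have WA := weight_graft a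
    have WB := weight_graft b
    have WC := weight_graft c
    by_cases h1 : i ≤ a.arity
    · have k1 : j ≤ a.arity := by omega
      have k2 : j ≤ (a.graft i q).arity := by have := A i q; have := arity_eq q; omega
      have k3 : i + r.arity - 1 ≤ (a.graft j r).arity := by have := A j r; omega
      obtain ⟨e1, e2, e3⟩ := ha i j hj hji h1
      simp only [graft, nodesAfter, h1, k1, k2, k3, if_true, e1, e2, e3]
      refine ⟨trivial, by omega, trivial⟩
    by_cases h2 : i ≤ a.arity + b.arity
    · by_cases k1 : j ≤ a.arity
      · have := A j r
        have g1 : ¬ i + r.arity - 1 ≤ (a.graft j r).arity := by omega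
        have g2 : i + r.arity - 1 ≤ (a.graft j r).arity + b.arity := by omega
        have g3 : i + r.arity - 1 - (a.graft j r).arity = i - a.arity := by omega
        simp only [graft, nodesAfter, h1, h2, k1, g1, g2, g3, if_true, if_false, WB]
        refine ⟨trivial, by omega, trivial⟩
      · have := B j r
        have := B (i - a.arity) q
        have := B (j - a.arity) r
        have := arity_eq q
        have g1 : j ≤ a.arity + b.arity := by omega
        have g2 : j ≤ a.arity + (b.graft (i - a.arity) q).arity := by omega
        have g3 : ¬ i + r.arity - 1 ≤ a.arity := by omega
        have g4 : i + r.arity - 1 ≤ a.arity + (b.graft (j - a.arity) r).arity := by omega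
        obtain ⟨e1, e2, e3⟩ := hb (i - a.arity) (j - a.arity) (by omega) (by omega) (by omega)
        rw [show i - a.arity + r.arity - 1 = i + r.arity - 1 - a.arity by omega] at e1 e3
        simp only [graft, nodesAfter, h1, h2, k1, g1, g2, g3, g4, if_true, if_false, e1, e2, e3]
        refine ⟨trivial, by omega, trivial⟩
    · by_cases k1 : j ≤ a.arity
      · have := A j r
        have g1 : ¬ i + r.arity - 1 ≤ (a.graft j r).arity := by omega
        have g2 : ¬ i + r.arity - 1 ≤ (a.graft j r).arity + b.arity := by omega
        have g3 : i + r.arity - 1 - ((a.graft j r).arity + b.arity) = i - (a.arity + b.arity) := by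
          omega
        simp only [graft, nodesAfter, h1, h2, k1, g1, g2, g3, if_true, if_false, WC]
        refine ⟨trivial, by omega, trivial⟩
      by_cases k2 : j ≤ a.arity + b.arity
      · have := B (j - a.arity) r
        have g1 : ¬ i + r.arity - 1 ≤ a.arity := by omega
        have g2 : ¬ i + r.arity - 1 ≤ a.arity + (b.graft (j - a.arity) r).arity := by omega
        have g3 : i + r.arity - 1 - (a.arity + (b.graft (j - a.arity) r).arity) =
          i - (a.arity + b.arity) := by omega
        simp only [graft, nodesAfter, h1, h2, k1, k2, g1, g2, g3, if_true, if_false, WC]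
        refine ⟨trivial, by omega, trivial⟩
      · have g1 : ¬ i + r.arity - 1 ≤ a.arity := by omega
        have g2 : ¬ i + r.arity - 1 ≤ a.arity + b.arity := by omega
        obtain ⟨e1, e2, e3⟩ := hc (i - (a.arity + b.arity)) (j - (a.arity + b.arity)) (by omega)
          (by omega) (by omega)
        rw [show i - (a.arity + b.arity) + r.arity - 1 = i + r.arity - 1 - (a.arity + b.arity) by
          omega] at e1 e3
        simp only [graft, nodesAfter, h1, h2, k1, k2, g1, g2, if_false, e1, e2, e3, and_self]

end TernaryTree

/-- The underlying vector space `LT` of the free nonsymmetric operad over `K` with one ternary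
generator: the vector space whose basis is the set of ternary trees. -/
abbrev TreePoly (K : Type*) [Field K] : Type _ := TernaryTree →₀ K

namespace TreePoly

variable (K : Type*) [Field K]

/-- The component `LT(n)` of arity `n`, with basis the trees with `n` leaves. -/
def ofArity (n : ℕ) : Submodule K (TreePoly K) :=
  Finsupp.supported K K {p : TernaryTree | p.arity = n}

variable {K}

/-- Partial composition `f ∘_i g` in the free nonsymmetric operad with one ternary generator of odd
degree, bilinear in `f` and `g`. A tree stands for the word of its internal nodes, all odd, in
planar preorder; so composing the tree `p` with the tree `q` at leaf `i` moves the internal nodes of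
`q` past the internal nodes of `p` after leaf `i`, and the Koszul sign is
`(-1) ^ (weight of q * number of these nodes)`. -/
noncomputable def comp (i : ℕ) (f g : TreePoly K) : TreePoly K :=
  f.sum fun p a => g.sum fun q b =>
    Finsupp.single (p.graft i q) ((-1 : K) ^ (q.weight * p.nodesAfter i) * (a * b))

theorem comp_single (p q : TernaryTree) (i : ℕ) (a b : K) :
    comp i (Finsupp.single p a) (Finsupp.single q b) =
      Finsupp.single (p.graft i q) ((-1 : K) ^ (q.weight * p.nodesAfter i) * (a * b)) := by
  simp [comp]

/-- Sequential composition law of operads (no sign). -/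
theorem comp_comp_inner (p q r : TernaryTree) (i j : ℕ) (hi : 1 ≤ i) (hp : i ≤ p.arity)
    (hij : i ≤ j) (hj : j < i + q.arity) :
    comp j (comp i (Finsupp.single p (1 : K)) (Finsupp.single q 1)) (Finsupp.single r 1) =
      comp i (Finsupp.single p 1) (comp (j + 1 - i) (Finsupp.single q 1) (Finsupp.single r 1)) := by
  obtain ⟨e1, e2⟩ := TernaryTree.graft_graft_inner p q r i j hi hp hij hj
  simp only [comp_single, e1, e2, TernaryTree.weight_graft, mul_one, one_mul]
  congr 1
  ring

/-- Parallel composition law of operads, with the Koszul sign. -/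
theorem comp_comp_parallel (p q r : TernaryTree) (i j : ℕ) (hj : 1 ≤ j) (hji : j < i)
    (hp : i ≤ p.arity) :
    comp j (comp i (Finsupp.single p (1 : K)) (Finsupp.single q 1)) (Finsupp.single r 1) =
      (-1 : K) ^ (q.weight * r.weight) •
        comp (i + r.arity - 1) (comp j (Finsupp.single p 1) (Finsupp.single r 1))
          (Finsupp.single q 1) := by
  obtain ⟨e1, e2, e3⟩ := TernaryTree.graft_graft_parallel p q r i j hj hji hp
  simp only [comp_single, e1, e2, e3, mul_one, Finsupp.smul_single, smul_eq_mul]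
  congr 1
  ring

variable (K)

/-- The generator `t`, as a tree polynomial. -/
noncomputable def gen : TreePoly K := Finsupp.single TernaryTree.basic 1

/-- The ternary partially associative relation `t ∘₁ t + t ∘₂ t + t ∘₃ t`. -/
noncomputable def alpha : TreePoly K :=
  comp 1 (gen K) (gen K) + comp 2 (gen K) (gen K) + comp 3 (gen K) (gen K)

variable {K}

/-- Operad ideals of the free operad: homogeneous subspaces (that is, spanned by their components of
each arity) closed under partial composition with arbitrary elements, on both sides. -/
structure IsOperadIdeal (S : Submodule K (TreePoly K)) : Prop where
  homogeneous : S = ⨆ n, S ⊓ ofArity K n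
  comp_mem : ∀ m n i : ℕ, 1 ≤ i → i ≤ m →
    ∀ f ∈ S ⊓ ofArity K m, ∀ g ∈ ofArity K n, comp i f g ∈ S
  mem_comp : ∀ m n j : ℕ, 1 ≤ j → j ≤ n →
    ∀ f ∈ S ⊓ ofArity K m, ∀ g ∈ ofArity K n, comp j g f ∈ S

variable (K)

/-- The operad ideal generated by the partially associative relation: the intersection of all operad
ideals that contain the relation. -/
noncomputable def paIdeal : Submodule K (TreePoly K) :=
  sInf {S | IsOperadIdeal S ∧ alpha K ∈ S}

/-- The ternary partially associative operad with an odd generator, as a vector space (the direct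
sum of its homogeneous components): the quotient of `LT` by the ideal. -/
abbrev OddTPA : Type _ := TreePoly K ⧸ paIdeal K

/-- The component of weight `w` of the ternary partially associative operad with an odd generator,
spanned by the classes of the trees with `w` internal nodes. -/
noncomputable def OddTPA.ofWeight (w : ℕ) : Submodule K (OddTPA K) :=
  (Finsupp.supported K K {p : TernaryTree | p.weight = w}).map (paIdeal K).mkQ

variable {K}

/-- `p` is the leading monomial of `f` in path-lex order: it occurs in `f`, and the path sequences
of all other trees that occur in `f` precede that of `p` lexicographically. -/
def IsLeadingMonomial (f : TreePoly K) (p : TernaryTree) : Prop :=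
  p ∈ f.support ∧ ∀ q ∈ f.support, q ≠ p → q.pathSeq < p.pathSeq

variable (K)

/-- Normal monomials: trees that are not the leading monomial of any element of the ideal. -/
def IsNormal (p : TernaryTree) : Prop :=
  ∀ f ∈ paIdeal K ⊓ ofArity K p.arity, ¬ IsLeadingMonomial f p

end TreePoly

/-! Read the relation as a rewriting rule. An internal left child makes the leftmost leaf one step
deeper than it is in the two other trees of the relation, so the rule replaces a tree by smaller
ones and stops at the trees without internal left child. These correspond to binary trees, by
deleting the leaf that is the left child of each internal node. What has to be shown is that no
further relation among them follows, that is, that rewriting is confluent.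

Instead of examining critical pairs, the proof builds a model. On the span of the binary trees the
rewriting rule defines a ternary product `prod`, by recursion on the first argument, and `prod_prod`
shows that this product is partially associative with Koszul signs. Evaluating trees in the model
therefore gives a linear map `normalForm` that vanishes on the ideal, which `paIdeal_eq` identifies
with the span of the instances of the relation inside trees. Conversely, each tree is congruent to
its normal form (`single_sub_ofBin_normalFormTree_mem`), so the ideal is exactly the kernel, and the
quotient in weight `w` has the binary trees with `w` nodes as a basis.

For leading monomials, `normalFormTree_mem_supported` says that normal forms involve no tree greater
than the one evaluated, while a normal tree evaluates to itself. Hence a normal tree that led an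
element of the ideal would survive in its normal form, which is zero. -/

set_option maxSynthPendingDepth 3

/-! ### The model: a partially associative product on binary trees -/

/-- The normal tree attached to a binary tree: each internal node acquires a leaf as left child. -/
def TernaryTree.ofBinary : BinaryTree Unit → TernaryTree
  | .nil => TernaryTree.leaf
  | .node _ x y => TernaryTree.node TernaryTree.leaf (ofBinary x) (ofBinary y)

/-- The vector space with basis the binary trees, a model of the partially associative operad. -/
abbrev BinPoly (K : Type*) [Field K] : Type _ := BinaryTree Unit →₀ K

namespace BinPoly

variable {K : Type*} [Field K]

/-- The basis vector of a binary tree. -/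
noncomputable def of (x : BinaryTree Unit) : BinPoly K := Finsupp.single x 1

variable (K) in
/-- The parity involution: the sign of the weight. -/
noncomputable def parity : BinPoly K →ₗ[K] BinPoly K :=
  Finsupp.linearCombination K fun x => (-1 : K) ^ x.numNodes • of x

variable (K) in
/-- The bilinear extension of the constructor of binary trees. -/
noncomputable def join : BinPoly K →ₗ[K] BinPoly K →ₗ[K] BinPoly K :=
  Finsupp.linearCombination K fun x =>
    Finsupp.linearCombination K fun y => of (BinaryTree.node () x y)

variable (K) in
/-- The ternary product of the model with a basis vector as first argument, obtained by rewriting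
with the partially associative relation. -/
noncomputable def prodTree : BinaryTree Unit → BinPoly K →ₗ[K] BinPoly K →ₗ[K] BinPoly K
  | .nil => join K
  -- Both recursive calls have a child of the given tree as first argument, so the rewriting is
  -- structurally recursive. The parity is the Koszul sign of an odd node that passes `x`.
  | .node _ x y => -((join K).comp (prodTree x (of y))) -
      (prodTree y).compr₂ (join K (parity K (of x)))

variable (K) in
/-- The ternary product of the model. -/
noncomputable def prod : BinPoly K →ₗ[K] BinPoly K →ₗ[K] BinPoly K →ₗ[K] BinPoly K :=
  Finsupp.linearCombination K (prodTree K)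

theorem parity_of (x : BinaryTree Unit) :
    parity K (of x) = (-1 : K) ^ x.numNodes • of x := by
  simp [parity, of]

theorem join_of (x y : BinaryTree Unit) :
    join K (of x) (of y) = of (BinaryTree.node () x y) := by
  simp [join, of]

theorem prod_of (x : BinaryTree Unit) : prod K (of x) = prodTree K x := by
  simp [prod, of]

theorem prod_nil : prod K (of .nil) = join K := by
  rw [prod_of, prodTree]

theorem parity_nil : parity K (of .nil) = of .nil := by
  simp [parity_of]

theorem induction_linear {P : BinPoly K → Prop} (a : BinPoly K) (zero : P 0)
    (add : ∀ a b, P a → P b → P (a + b)) (smul : ∀ (c : K) a, P a → P (c • a))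
    (tree : ∀ x, P (of x)) : P a := by
  induction a using Finsupp.induction_linear with
  | zero => exact zero
  | add a b ha hb => exact add a b ha hb
  | single x c =>
    have : Finsupp.single x c = c • (of x : BinPoly K) := by simp [of]
    rw [this]
    exact smul c _ (tree x)

theorem parity_parity (a : BinPoly K) : parity K (parity K a) = a := by
  induction a using induction_linear with
  | zero => simp
  | add a b ha hb => rw [map_add, map_add, ha, hb]
  | smul c a ha => rw [map_smul, map_smul, ha]
  | tree x => simp [parity_of, smul_smul, ← mul_pow]

/-- The node created by `join` is odd, whence the minus sign. This sign and the one in `parity_prod`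
make the mixed terms of `prod_prod` cancel. -/
theorem parity_join (a b : BinPoly K) :
    parity K (join K a b) = -join K (parity K a) (parity K b) := by
  induction a using induction_linear with
  | zero => simp
  | add a a' ha hb => simp only [map_add, LinearMap.add_apply, ha, hb]; abel
  | smul c a ha => simp only [map_smul, LinearMap.smul_apply, ha, smul_neg]
  | tree x =>
    induction b using induction_linear with
    | zero => simp
    | add a a' ha hb => simp only [map_add, ha, hb]; abel
    | smul c a ha => simp only [map_smul, ha, smul_neg]
    | tree y =>
      simp only [parity_of, map_smul, LinearMap.smul_apply, join_of, BinaryTree.numNodes, smul_smul,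
        ← neg_smul]
      congr 1
      ring

/-- The rewriting rule that defines the product. -/
theorem prod_join (a b c d : BinPoly K) :
    prod K (join K a b) c d =
      -join K (prod K a b c) d - join K (parity K a) (prod K b c d) := by
  induction a using induction_linear with
  | zero => simp
  | add a a' ha hb => simp only [map_add, LinearMap.add_apply, ha, hb]; abel
  | smul c a ha => simp only [map_smul, LinearMap.smul_apply, ha, smul_neg, smul_sub]
  | tree x =>
    induction b using induction_linear with
    | zero => simp
    | add a a' ha hb => simp only [map_add, LinearMap.add_apply, ha, hb]; abel
    | smul c a ha => simp only [map_smul, LinearMap.smul_apply, ha, smul_neg, smul_sub]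
    | tree y => simp [join_of, prod_of, prodTree]

theorem parity_prod (a b c : BinPoly K) :
    parity K (prod K a b c) = -prod K (parity K a) (parity K b) (parity K c) := by
  induction a using induction_linear with
  | zero => simp
  | add a a' ha hb => simp only [map_add, LinearMap.add_apply, ha, hb]; abel
  | smul c a ha => simp only [map_smul, LinearMap.smul_apply, ha, smul_neg]
  | tree x =>
    induction x generalizing b c with
    | nil => rw [parity_nil, prod_nil, parity_join]
    | node u x y hx hy =>
      rw [← join_of, prod_join, parity_join, map_neg, LinearMap.neg_apply, LinearMap.neg_apply,
        prod_join]
      simp only [map_sub, map_neg, parity_join, hx, hy, LinearMap.neg_apply, neg_neg]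

/-- The model is partially associative. -/
theorem prod_prod (a b c d e : BinPoly K) :
    prod K (prod K a b c) d e + prod K (parity K a) (prod K b c d) e +
      prod K (parity K a) (parity K b) (prod K c d e) = 0 := by
  induction a using induction_linear with
  | zero => simp
  | add a a' ha hb =>
    simp only [map_add, LinearMap.add_apply]
    rw [← add_zero (0 : BinPoly K)]
    nth_rw 1 [← ha]
    rw [← hb]
    abel
  | smul k a ha =>
    simp only [map_smul, LinearMap.smul_apply, ← smul_add, ha, smul_zero]
  | tree x =>
    induction x generalizing b c d e with
    | nil =>
      simp only [parity_nil, prod_nil, prod_join]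
      abel
    | node u x y hx hy =>
      -- After expansion by `prod_join`, the terms with last argument `e` under the outer `join`
      -- form the identity for `x`, and those with first argument `x` form the identity for `y`. The
      -- two terms that pair a product of `x`, `y`, `b` with the product of `c`, `d`, `e` have
      -- opposite signs.
      have h1 := congrArg (fun v => join K v e) (hx (of y) b c d)
      have h2 := congrArg (join K (of x)) (hy b c d e)
      simp only [map_add, map_zero, LinearMap.add_apply, LinearMap.zero_apply] at h1 h2
      rw [← join_of]
      simp only [prod_join, parity_join, map_sub, map_neg, LinearMap.sub_apply, LinearMap.neg_apply,
        parity_parity, parity_prod] at h1 h2 ⊢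
      linear_combination (norm := module) h1 + h2

end BinPoly

/-! ### Compatibility of path-lex order with the tree constructor -/

namespace TernaryTree

theorem pathSeq_length (p : TernaryTree) : p.pathSeq.length = p.arity := by
  induction p with
  | leaf => rfl
  | node l m r hl hm hr => simp [pathSeq, arity, hl, hm, hr]; omega

/-- Equal length excludes a proper prefix, so the first difference occurs inside `a` and `b` and the
tails play no role. -/
theorem append_lt_append_left {a b c d : List ℕ} (hlen : a.length = b.length) (h : a < b) :
    a ++ c < b ++ d := by
  induction a generalizing b with
  | nil =>
    cases b with
    | nil => exact absurd h (lt_irrefl _)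
    | cons y b => simp at hlen
  | cons x a ih =>
    cases b with
    | nil => simp at hlen
    | cons y b =>
      rw [List.cons_lt_cons_iff] at h
      rw [List.cons_append, List.cons_append, List.cons_lt_cons_iff]
      exact h.imp_right fun h => ⟨h.1, ih (by simpa using hlen) h.2⟩

theorem append_lt_append_right (a : List ℕ) {b c : List ℕ} (h : b < c) : a ++ b < a ++ c := by
  induction a with
  | nil => exact h
  | cons x a ih =>
    rw [List.cons_append, List.cons_append, List.cons_lt_cons_iff]
    exact Or.inr ⟨rfl, ih⟩

theorem map_succ_lt_map_succ {a b : List ℕ} (h : a < b) :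
    a.map (· + 1) < b.map (· + 1) := by
  induction a generalizing b with
  | nil =>
    cases b with
    | nil => exact absurd h (lt_irrefl _)
    | cons y b => simp
  | cons x a ih =>
    cases b with
    | nil => simp at h
    | cons y b =>
      rw [List.cons_lt_cons_iff] at h
      rw [List.map_cons, List.map_cons, List.cons_lt_cons_iff]
      exact h.imp (fun h => by omega) fun h => ⟨by rw [h.1], ih h.2⟩

section Order

variable {l l' m m' r r' : TernaryTree}

theorem length_pathSeq_eq (h : l.weight = l'.weight) : l.pathSeq.length = l'.pathSeq.length := by
  rw [pathSeq_length, pathSeq_length, arity_eq, arity_eq, h]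

theorem pathSeq_node_lt_left (h : l.weight = l'.weight) (hl : l.pathSeq < l'.pathSeq) :
    (node l m r).pathSeq < (node l' m' r').pathSeq := by
  simp only [pathSeq, List.append_assoc]
  exact map_succ_lt_map_succ (append_lt_append_left (length_pathSeq_eq h) hl)

theorem pathSeq_node_lt_mid (h : m.weight = m'.weight) (hm : m.pathSeq < m'.pathSeq) :
    (node l m r).pathSeq < (node l m' r').pathSeq := by
  simp only [pathSeq, List.append_assoc]
  exact map_succ_lt_map_succ (append_lt_append_right _
    (append_lt_append_left (length_pathSeq_eq h) hm))

theorem pathSeq_node_lt_right (hr : r.pathSeq < r'.pathSeq) :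
    (node l m r).pathSeq < (node l m r').pathSeq := by
  simp only [pathSeq, List.append_assoc]
  exact map_succ_lt_map_succ (append_lt_append_right _ (append_lt_append_right _ hr))

theorem pathSeq_head (p : TernaryTree) : ∃ n s, p.pathSeq = n :: s := by
  cases h : p.pathSeq with
  | nil => have := pathSeq_length p; have := arity_eq p; simp_all
  | cons n s => exact ⟨n, s, rfl⟩

/-- The first entry already decides: the leftmost leaf of `a` is one level deeper on the right-hand
side. -/
theorem pathSeq_node_lt_node_node (a b c d e m r : TernaryTree) :
    (node a m r).pathSeq < (node (node a b c) d e).pathSeq := by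
  obtain ⟨n, s, h⟩ := pathSeq_head a
  simp [pathSeq, h, List.cons_lt_cons_iff]

end Order

end TernaryTree
open TernaryTree

/-! ### The ideal as the span of the relation instances -/

namespace TreePoly

variable (K : Type*) [Field K]

/-- `Relation K p q r x y` says that `p + x • q + y • r` is an instance of the partially associative
relation inside a ternary tree. -/
inductive Relation : TernaryTree → TernaryTree → TernaryTree → K → K → Prop
  -- In planar preorder the inner node precedes `a` in the first tree, follows `a` in the second,
  -- and follows `a` and `b` in the third; the coefficients are the signs of these moves.
  | base (a b c d e : TernaryTree) : Relation (node (node a b c) d e) (node a (node b c d) e)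
      (node a b (node c d e)) ((-1) ^ a.weight) ((-1) ^ (a.weight + b.weight))
  | left {p q r x y} (b c : TernaryTree) (h : Relation p q r x y) :
      Relation (node p b c) (node q b c) (node r b c) x y
  | mid {p q r x y} (a c : TernaryTree) (h : Relation p q r x y) :
      Relation (node a p c) (node a q c) (node a r c) x y
  | right {p q r x y} (a b : TernaryTree) (h : Relation p q r x y) :
      Relation (node a b p) (node a b q) (node a b r) x y

variable {K}

/-- The tree polynomial `p + x • q + y • r`. -/
noncomputable def trinomial (p q r : TernaryTree) (x y : K) : TreePoly K :=
  Finsupp.single p 1 + Finsupp.single q x + Finsupp.single r y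

variable (K) in
/-- The subspace spanned by the instances of the partially associative relation. -/
noncomputable def relationSpan : Submodule K (TreePoly K) :=
  Submodule.span K {f | ∃ p q r x y, Relation K p q r x y ∧ f = trinomial p q r x y}

theorem single_mem_ofArity (p : TernaryTree) (c : K) :
    Finsupp.single p c ∈ ofArity K p.arity :=
  Finsupp.single_mem_supported K _ rfl

theorem trinomial_mem_ofArity {p q r : TernaryTree} (hq : q.arity = p.arity)
    (hr : r.arity = p.arity) (x y : K) : trinomial p q r x y ∈ ofArity K p.arity :=
  add_mem (add_mem (single_mem_ofArity _ _) (hq ▸ single_mem_ofArity _ _))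
    (hr ▸ single_mem_ofArity _ _)

namespace Relation

variable {p q r : TernaryTree} {x y : K}

theorem weight_eq (h : Relation K p q r x y) : q.weight = p.weight ∧ r.weight = p.weight := by
  induction h with
  | base a b c d e => simp only [weight]; omega
  | left b c h ih => simp only [weight]; omega
  | mid a c h ih => simp only [weight]; omega
  | right a b h ih => simp only [weight]; omega

theorem arity_eq (h : Relation K p q r x y) : q.arity = p.arity ∧ r.arity = p.arity := by
  simp [TernaryTree.arity_eq, h.weight_eq]

theorem pathSeq_lt (h : Relation K p q r x y) :
    q.pathSeq < p.pathSeq ∧ r.pathSeq < p.pathSeq := by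
  induction h with
  | base a b c d e => exact ⟨pathSeq_node_lt_node_node .., pathSeq_node_lt_node_node ..⟩
  | left b c h ih =>
    exact ⟨pathSeq_node_lt_left h.weight_eq.1 ih.1, pathSeq_node_lt_left h.weight_eq.2 ih.2⟩
  | mid a c h ih =>
    exact ⟨pathSeq_node_lt_mid h.weight_eq.1 ih.1, pathSeq_node_lt_mid h.weight_eq.2 ih.2⟩
  | right a b h ih => exact ⟨pathSeq_node_lt_right ih.1, pathSeq_node_lt_right ih.2⟩

theorem mem_relationSpan (h : Relation K p q r x y) : trinomial p q r x y ∈ relationSpan K :=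
  Submodule.subset_span ⟨p, q, r, x, y, h, rfl⟩

theorem trinomial_mem_ofArity (h : Relation K p q r x y) :
    trinomial p q r x y ∈ ofArity K p.arity :=
  TreePoly.trinomial_mem_ofArity h.arity_eq.1 h.arity_eq.2 x y

theorem isLeadingMonomial (h : Relation K p q r x y) :
    IsLeadingMonomial (trinomial p q r x y) p := by
  have hq : q ≠ p := by rintro rfl; exact lt_irrefl _ h.pathSeq_lt.1
  have hr : r ≠ p := by rintro rfl; exact lt_irrefl _ h.pathSeq_lt.2
  refine ⟨by simp [trinomial, hq, hr], fun s hs hsp => ?_⟩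
  by_cases hsq : s = q
  · exact hsq ▸ h.pathSeq_lt.1
  by_cases hsr : s = r
  · exact hsr ▸ h.pathSeq_lt.2
  · exact absurd hs (by simp [trinomial, Ne.symm hsp, Ne.symm hsq, Ne.symm hsr])

/-- Grafting a tree into an instance of the relation gives an instance, up to the Koszul sign. -/
theorem graft_right (h : Relation K p q r x y) (i : ℕ) (s : TernaryTree) :
    ∃ x' y', Relation K (p.graft i s) (q.graft i s) (r.graft i s) x' y' ∧
      (-1) ^ (s.weight * q.nodesAfter i) * x = (-1) ^ (s.weight * p.nodesAfter i) * x' ∧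
      (-1) ^ (s.weight * r.nodesAfter i) * y = (-1) ^ (s.weight * p.nodesAfter i) * y' := by
  induction h generalizing i with
  | base a b c d e =>
    simp only [graft, nodesAfter, arity, Nat.sub_sub, tsub_le_iff_left, ← add_assoc]
    -- The cases say which of the five subtrees receives `s`. If it is `a` or `b`, the weight in the
    -- coefficient grows by that of `s`, and this matches the inner node having moved to the other
    -- side of leaf `i`.
    by_cases h1 : i ≤ a.arity <;> by_cases h2 : i ≤ a.arity + b.arity <;>
      by_cases h3 : i ≤ a.arity + b.arity + c.arity <;>
      by_cases h4 : i ≤ a.arity + b.arity + c.arity + d.arity <;> first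
      | omega
      | (simp only [h1, h2, h3, h4, if_true, if_false]
         refine ⟨_, _, base _ _ _ _ _, ?_, ?_⟩ <;> simp only [weight, weight_graft] <;> ring)
  | @left p q r x y b c h ih =>
    simp only [graft, nodesAfter, h.arity_eq]
    obtain ⟨x', y', h', hx, hy⟩ := ih i
    split_ifs
    · refine ⟨x', y', h'.left _ _, ?_, ?_⟩ <;> simp only [mul_add, pow_add]
      · linear_combination (-1) ^ (s.weight * b.weight) * (-1) ^ (s.weight * c.weight) * hx
      · linear_combination (-1) ^ (s.weight * b.weight) * (-1) ^ (s.weight * c.weight) * hy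
    · exact ⟨x, y, h.left _ _, rfl, rfl⟩
    · exact ⟨x, y, h.left _ _, rfl, rfl⟩
  | @mid p q r x y a c h ih =>
    simp only [graft, nodesAfter, h.arity_eq, h.weight_eq]
    obtain ⟨x', y', h', hx, hy⟩ := ih (i - a.arity)
    split_ifs
    · exact ⟨x, y, h.mid _ _, rfl, rfl⟩
    · refine ⟨x', y', h'.mid _ _, ?_, ?_⟩ <;> simp only [mul_add, pow_add]
      · linear_combination (-1) ^ (s.weight * c.weight) * hx
      · linear_combination (-1) ^ (s.weight * c.weight) * hy
    · exact ⟨x, y, h.mid _ _, rfl, rfl⟩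
  | @right p q r x y a b h ih =>
    simp only [graft, nodesAfter, h.weight_eq]
    obtain ⟨x', y', h', hx, hy⟩ := ih (i - (a.arity + b.arity))
    split_ifs
    · exact ⟨x, y, h.right _ _, rfl, rfl⟩
    · exact ⟨x, y, h.right _ _, rfl, rfl⟩
    · exact ⟨x', y', h'.right _ _, hx, hy⟩

/-- Grafting an instance of the relation into a tree gives an instance. -/
theorem graft_left (h : Relation K p q r x y) (j : ℕ) (s : TernaryTree) :
    Relation K (s.graft j p) (s.graft j q) (s.graft j r) x y := by
  induction s generalizing j with
  | leaf => exact h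
  | node a b c ha hb hc =>
    simp only [graft]
    split_ifs
    · exact (ha _).left _ _
    · exact (hb _).mid _ _
    · exact (hc _).right _ _

end Relation

/-- A tree with an internal node that is a left child is the first tree of a relation. -/
theorem exists_relation {p : TernaryTree} (h : ¬ p.NoLeftInternal) :
    ∃ q r x y, Relation K p q r x y := by
  induction p with
  | leaf => exact absurd trivial h
  | node l m s hl hm hs =>
    cases l with
    | node a b c => exact ⟨_, _, _, _, .base a b c m s⟩
    | leaf =>
      by_cases h1 : m.NoLeftInternal
      · obtain ⟨q, r, x, y, h⟩ := hs fun h2 => h ⟨rfl, h1, h2⟩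
        exact ⟨_, _, _, _, h.right _ _⟩
      · obtain ⟨q, r, x, y, h⟩ := hm h1
        exact ⟨_, _, _, _, h.mid _ _⟩

/-- Partial composition as a bilinear map. -/
noncomputable def compLin (i : ℕ) : TreePoly K →ₗ[K] TreePoly K →ₗ[K] TreePoly K :=
  Finsupp.linearCombination K fun p => Finsupp.linearCombination K fun q =>
    Finsupp.single (p.graft i q) ((-1 : K) ^ (q.weight * p.nodesAfter i))

theorem compLin_apply (i : ℕ) (f g : TreePoly K) : compLin i f g = comp i f g := by
  rw [compLin, Finsupp.linearCombination_apply, Finsupp.sum, LinearMap.sum_apply, comp]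
  refine Finset.sum_congr rfl fun p _ => ?_
  rw [LinearMap.smul_apply, Finsupp.linearCombination_apply, Finsupp.smul_sum]
  refine Finset.sum_congr rfl fun q _ => ?_
  simp only [Finsupp.smul_single, smul_eq_mul]
  congr 1
  ring

theorem comp_trinomial_left (p q r s : TernaryTree) (x y : K) (i : ℕ) :
    comp i (trinomial p q r x y) (Finsupp.single s 1) =
      Finsupp.single (p.graft i s) ((-1) ^ (s.weight * p.nodesAfter i)) +
      Finsupp.single (q.graft i s) ((-1) ^ (s.weight * q.nodesAfter i) * x) +
      Finsupp.single (r.graft i s) ((-1) ^ (s.weight * r.nodesAfter i) * y) := by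
  rw [← compLin_apply, trinomial]
  simp only [map_add, LinearMap.add_apply, compLin_apply, comp_single, mul_one]

theorem Relation.comp_right {p q r s : TernaryTree} {x y : K} (h : Relation K p q r x y) (j : ℕ) :
    comp j (Finsupp.single s 1) (trinomial p q r x y) =
      (-1 : K) ^ (p.weight * s.nodesAfter j) •
        trinomial (s.graft j p) (s.graft j q) (s.graft j r) x y := by
  rw [← compLin_apply, trinomial]
  simp only [map_add, compLin_apply, comp_single, h.weight_eq, trinomial, smul_add,
    Finsupp.smul_single, smul_eq_mul, mul_one, one_mul]

theorem comp_mem_of_forall_single {S : Submodule K (TreePoly K)} {i : ℕ} {f : TreePoly K}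
    (h : ∀ s, comp i f (Finsupp.single s 1) ∈ S) (g : TreePoly K) : comp i f g ∈ S := by
  induction g using Finsupp.induction_linear with
  | zero => rw [← compLin_apply, map_zero]; exact zero_mem S
  | add a b ha hb => rw [← compLin_apply, map_add, compLin_apply, compLin_apply]; exact add_mem ha hb
  | single s c =>
    rw [← mul_one c, ← smul_eq_mul, ← Finsupp.smul_single, ← compLin_apply, map_smul, compLin_apply]
    exact S.smul_mem _ (h s)

theorem mem_comp_of_forall_single {S : Submodule K (TreePoly K)} {i : ℕ} {f : TreePoly K}
    (h : ∀ s, comp i (Finsupp.single s 1) f ∈ S) (g : TreePoly K) : comp i g f ∈ S := by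
  induction g using Finsupp.induction_linear with
  | zero => rw [← compLin_apply, map_zero]; exact zero_mem S
  | add a b ha hb =>
    rw [← compLin_apply, map_add, LinearMap.add_apply, compLin_apply, compLin_apply]
    exact add_mem ha hb
  | single s c =>
    rw [← mul_one c, ← smul_eq_mul, ← Finsupp.smul_single, ← compLin_apply, map_smul,
      LinearMap.smul_apply, compLin_apply]
    exact S.smul_mem _ (h s)

/-- The Koszul signs of the three terms may differ, but `graft_right` shows that up to one common
sign they are absorbed into the coefficients of another instance. No range condition on `i` is
needed. -/
theorem comp_mem_relationSpan (i : ℕ) {f : TreePoly K} (hf : f ∈ relationSpan K) (g : TreePoly K) :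
    comp i f g ∈ relationSpan K := by
  refine comp_mem_of_forall_single (fun s => ?_) g
  have : relationSpan K ≤ (relationSpan K).comap ((compLin i).flip (Finsupp.single s 1)) := by
    refine Submodule.span_le.2 ?_
    rintro _ ⟨p, q, r, x, y, h, rfl⟩
    obtain ⟨x', y', h', hx, hy⟩ := h.graft_right i s
    have e : comp i (trinomial p q r x y) (Finsupp.single s 1) =
        (-1 : K) ^ (s.weight * p.nodesAfter i) •
          trinomial (p.graft i s) (q.graft i s) (r.graft i s) x' y' := by
      rw [comp_trinomial_left, hx, hy]
      simp only [trinomial, smul_add, Finsupp.smul_single, smul_eq_mul, mul_one]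
    rw [SetLike.mem_coe, Submodule.mem_comap, LinearMap.flip_apply, compLin_apply, e]
    exact Submodule.smul_mem _ _ h'.mem_relationSpan
  have := this hf
  rwa [Submodule.mem_comap, LinearMap.flip_apply, compLin_apply] at this

theorem mem_comp_relationSpan (i : ℕ) {f : TreePoly K} (hf : f ∈ relationSpan K) (g : TreePoly K) :
    comp i g f ∈ relationSpan K := by
  refine mem_comp_of_forall_single (fun s => ?_) g
  have : relationSpan K ≤ (relationSpan K).comap (compLin i (Finsupp.single s 1)) := by
    refine Submodule.span_le.2 ?_
    rintro _ ⟨p, q, r, x, y, h, rfl⟩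
    rw [SetLike.mem_coe, Submodule.mem_comap, compLin_apply, h.comp_right]
    exact Submodule.smul_mem _ _ (h.graft_left i s).mem_relationSpan
  have := this hf
  rwa [Submodule.mem_comap, compLin_apply] at this

theorem isOperadIdeal_relationSpan : IsOperadIdeal (relationSpan K) where
  homogeneous := by
    refine le_antisymm (Submodule.span_le.2 ?_) (iSup_le fun n => inf_le_left)
    rintro _ ⟨p, q, r, x, y, h, rfl⟩
    exact Submodule.mem_iSup_of_mem p.arity ⟨h.mem_relationSpan, h.trinomial_mem_ofArity⟩
  comp_mem _ _ i _ _ _ hf g _ := comp_mem_relationSpan i hf.1 g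
  mem_comp _ _ j _ _ _ hf g _ := mem_comp_relationSpan j hf.1 g

theorem alpha_eq : alpha K = trinomial (node basic leaf leaf) (node leaf basic leaf)
    (node leaf leaf basic) 1 1 := by
  simp [alpha, gen, comp_single, trinomial, basic, graft, nodesAfter, arity, weight]

theorem alpha_mem_relationSpan : alpha K ∈ relationSpan K := by
  rw [alpha_eq]
  simpa [weight, basic] using (Relation.base (K := K) leaf leaf leaf leaf leaf).mem_relationSpan

namespace IsOperadIdeal

variable {S : Submodule K (TreePoly K)}

/-- The sign belonging to `p` is a unit and is divided out, so only the excesses `k` and `l` of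
nodes after leaf `i` remain in the coefficients. -/
theorem trinomial_graft_mem (hS : IsOperadIdeal S) {p q r : TernaryTree} {x y : K}
    (hf : trinomial p q r x y ∈ S) (hq : q.arity = p.arity) (hr : r.arity = p.arity) (i : ℕ)
    (hi : 1 ≤ i) (hip : i ≤ p.arity) (s : TernaryTree) (k l : ℕ)
    (hk : q.nodesAfter i = p.nodesAfter i + k) (hl : r.nodesAfter i = p.nodesAfter i + l) :
    trinomial (p.graft i s) (q.graft i s) (r.graft i s) ((-1) ^ (s.weight * k) * x)
      ((-1) ^ (s.weight * l) * y) ∈ S := by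
  have := hS.comp_mem _ _ i hi hip _ ⟨hf, trinomial_mem_ofArity hq hr x y⟩ _
    (single_mem_ofArity s 1)
  rw [comp_trinomial_left, hk, hl] at this
  refine (S.smul_mem_iff (pow_ne_zero (s.weight * p.nodesAfter i)
    (neg_ne_zero.2 (one_ne_zero (α := K))))).1 ?_
  simpa only [trinomial, smul_add, Finsupp.smul_single, smul_eq_mul, mul_one, ← mul_assoc,
    ← pow_add, ← mul_add] using this

theorem trinomial_base_mem (hS : IsOperadIdeal S) (hα : alpha K ∈ S) (a b c d e : TernaryTree) :
    trinomial (node (node a b c) d e) (node a (node b c d) e) (node a b (node c d e))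
      ((-1 : K) ^ a.weight) ((-1) ^ (a.weight + b.weight)) ∈ S := by
  rw [alpha_eq] at hα
  -- The five leaves of `alpha` are filled from right to left, so that the numbers of the leaves
  -- still empty do not change. The excesses are nonzero only at leaf 2, where the inner node comes
  -- later in the third tree, and at leaf 1, where it comes later in the second and third.
  have h5 : trinomial (node (node leaf leaf leaf) leaf e) (node leaf (node leaf leaf leaf) e)
      (node leaf leaf (node leaf leaf e)) (1 : K) 1 ∈ S := by
    simpa [graft, basic, arity] using hS.trinomial_graft_mem hα (by simp [basic, arity])
      (by simp [basic, arity]) 5 (by simp) (by simp [basic, arity]) e 0 0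
      (by simp [basic, arity, nodesAfter]) (by simp [basic, arity, nodesAfter])
  have h4 : trinomial (node (node leaf leaf leaf) d e) (node leaf (node leaf leaf d) e)
      (node leaf leaf (node leaf d e)) (1 : K) 1 ∈ S := by
    simpa [graft, arity] using hS.trinomial_graft_mem h5 (by simp only [arity])
      (by simp only [arity]; omega) 4 (by norm_num) (by simp only [arity]; omega) d 0 0
      (by simp [arity, nodesAfter]) (by simp [arity, nodesAfter])
  have c3 : 3 ≤ 1 + (2 + d.arity) := by omega
  have c2 : 2 ≤ 1 + (1 + c.arity + d.arity) := by omega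
  have c1 : 1 ≤ 1 + b.arity + c.arity := by omega
  have c1' : 1 ≤ 1 + b.arity + c.arity + d.arity := by omega
  have h3 : trinomial (node (node leaf leaf c) d e) (node leaf (node leaf c d) e)
      (node leaf leaf (node c d e)) (1 : K) 1 ∈ S := by
    simpa [graft, arity, c3] using hS.trinomial_graft_mem h4 (by simp only [arity]; omega)
      (by simp only [arity]; omega) 3 (by norm_num) (by simp only [arity]; omega) c 0 0
      (by simp [arity, nodesAfter, c3]) (by simp [arity, nodesAfter])
  have h2 : trinomial (node (node leaf b c) d e) (node leaf (node b c d) e)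
      (node leaf b (node c d e)) (1 : K) ((-1) ^ b.weight) ∈ S := by
    simpa [graft, arity, c2] using hS.trinomial_graft_mem h3 (by simp only [arity]; omega)
      (by simp only [arity]; omega) 2 (by norm_num) (by simp only [arity]; omega) b 0 1
      (by simp [arity, nodesAfter, c2]) (by simp [arity, nodesAfter, weight])
  simpa [graft, arity, pow_add, c1, c1'] using hS.trinomial_graft_mem h2 (by simp only [arity]; omega)
      (by simp only [arity]; omega) 1 (by norm_num) (by simp only [arity]; omega) a 1 1
      (by simp [arity, nodesAfter, weight, c1]; omega)
      (by simp [arity, nodesAfter, weight, c1]; omega)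

theorem trinomial_mem (hS : IsOperadIdeal S)
    (hα : alpha K ∈ S) {p q r : TernaryTree} {x y : K} (h : Relation K p q r x y) :
    trinomial p q r x y ∈ S := by
  -- The three trees of an instance have equal weight, so composing on the outside produces one
  -- common sign, which can be cancelled.
  have key (s : TernaryTree) (j : ℕ) (hj : 1 ≤ j) (hj' : j ≤ s.arity) {p q r : TernaryTree}
      {x y : K} (h : Relation K p q r x y) (ih : trinomial p q r x y ∈ S) :
      trinomial (s.graft j p) (s.graft j q) (s.graft j r) x y ∈ S := by
    have := hS.mem_comp _ _ j hj hj' _ ⟨ih, h.trinomial_mem_ofArity⟩ _ (single_mem_ofArity s 1)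
    rw [h.comp_right] at this
    exact (S.smul_mem_iff (pow_ne_zero _ (neg_ne_zero.2 one_ne_zero))).1 this
  induction h with
  | base a b c d e => exact hS.trinomial_base_mem hα a b c d e
  | left b c h ih =>
    have := key (node leaf b c) 1 le_rfl (by simp [arity]; omega) h ih
    simpa [graft, arity] using this
  | mid a c h ih =>
    have := key (node a leaf c) (a.arity + 1) (by omega) (by simp [arity]) h ih
    simpa [graft, arity] using this
  | right a b h ih =>
    have := key (node a b leaf) (a.arity + b.arity + 1) (by omega) (by simp [arity]) h ih
    have h1 : ¬ a.arity + b.arity + 1 ≤ a.arity := by omega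
    simpa [graft, arity, h1] using this

end IsOperadIdeal

theorem paIdeal_eq : paIdeal K = relationSpan K := by
  refine le_antisymm (sInf_le ⟨isOperadIdeal_relationSpan, alpha_mem_relationSpan⟩)
    (le_sInf fun S hS => Submodule.span_le.2 ?_)
  rintro _ ⟨p, q, r, x, y, h, rfl⟩
  exact hS.1.trinomial_mem hS.2 h

end TreePoly

/-! ### Evaluation of ternary trees in the model -/

theorem TernaryTree.weight_ofBinary (x : BinaryTree Unit) : (ofBinary x).weight = x.numNodes := by
  induction x with
  | nil => rfl
  | node u x y hx hy => simp [ofBinary, weight, BinaryTree.numNodes, hx, hy]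

theorem TernaryTree.exists_ofBinary {p : TernaryTree} (h : p.NoLeftInternal) :
    ∃ x, ofBinary x = p := by
  induction p with
  | leaf => exact ⟨.nil, rfl⟩
  | node l m r _ hm hr =>
    obtain ⟨rfl, h1, h2⟩ := h
    obtain ⟨x, rfl⟩ := hm h1
    obtain ⟨y, rfl⟩ := hr h2
    exact ⟨.node () x y, rfl⟩

namespace TreePoly
open BinPoly

variable {K : Type*} [Field K]

variable (K) in
/-- The normal form of a tree, in the model. -/
noncomputable def normalFormTree : TernaryTree → BinPoly K
  | leaf => of .nil
  | node l m r => prod K (normalFormTree l) (normalFormTree m) (normalFormTree r)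

variable (K) in
/-- The normal form of a tree polynomial, in the model. -/
noncomputable def normalForm : TreePoly K →ₗ[K] BinPoly K :=
  Finsupp.linearCombination K (normalFormTree K)

theorem normalForm_single (p : TernaryTree) (c : K) :
    normalForm K (Finsupp.single p c) = c • normalFormTree K p := by
  simp [normalForm]

/-- Turns the parities in `prod_prod` into the signs of `Relation.base`. -/
theorem parity_normalFormTree (p : TernaryTree) :
    parity K (normalFormTree K p) = (-1 : K) ^ p.weight • normalFormTree K p := by
  induction p with
  | leaf => simp [normalFormTree, parity_nil, weight]
  | node l m r hl hm hr =>
    simp only [normalFormTree, parity_prod, hl, hm, hr, map_smul, LinearMap.smul_apply, smul_smul,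
      ← neg_smul, weight]
    congr 1
    ring

theorem Relation.normalFormTree_eq_zero {p q r : TernaryTree} {x y : K} (h : Relation K p q r x y) :
    normalFormTree K p + x • normalFormTree K q + y • normalFormTree K r = 0 := by
  induction h with
  | base a b c d e =>
    have := prod_prod (normalFormTree K a) (normalFormTree K b) (normalFormTree K c)
      (normalFormTree K d) (normalFormTree K e)
    simp only [parity_normalFormTree, map_smul, LinearMap.smul_apply, smul_smul] at this
    simp only [normalFormTree]
    rw [pow_add, mul_comm ((-1 : K) ^ a.weight)]
    exact this
  | left b c h ih =>
    have := congrArg (fun v => prod K v (normalFormTree K b) (normalFormTree K c)) ih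
    simpa only [normalFormTree, map_add, map_smul, map_zero, LinearMap.add_apply,
      LinearMap.smul_apply, LinearMap.zero_apply] using this
  | mid a c h ih =>
    have := congrArg (fun v => prod K (normalFormTree K a) v (normalFormTree K c)) ih
    simpa only [normalFormTree, map_add, map_smul, map_zero, LinearMap.add_apply,
      LinearMap.smul_apply, LinearMap.zero_apply] using this
  | right a b h ih =>
    have := congrArg (fun v => prod K (normalFormTree K a) (normalFormTree K b) v) ih
    simpa only [normalFormTree, map_add, map_smul, map_zero] using this

theorem relationSpan_le_ker : relationSpan K ≤ LinearMap.ker (normalForm K) := by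
  refine Submodule.span_le.2 ?_
  rintro _ ⟨p, q, r, x, y, h, rfl⟩
  simpa only [trinomial, SetLike.mem_coe, LinearMap.mem_ker, map_add, normalForm_single, one_smul]
    using h.normalFormTree_eq_zero

/-! ### Every tree is congruent to its normal form -/

variable (K) in
/-- The embedding of the model in the tree polynomials as the span of the normal trees. -/
noncomputable def ofBin : BinPoly K →ₗ[K] TreePoly K := Finsupp.lmapDomain K K ofBinary

theorem ofBin_of (x : BinaryTree Unit) : ofBin K (of x) = Finsupp.single (ofBinary x) 1 := by
  simp [ofBin, of]

variable (K) in
/-- The trilinear extension of the constructor of ternary trees. -/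
noncomputable def nodeLin : TreePoly K →ₗ[K] TreePoly K →ₗ[K] TreePoly K →ₗ[K] TreePoly K :=
  Finsupp.linearCombination K fun l => Finsupp.linearCombination K fun m =>
    Finsupp.linearCombination K fun r => Finsupp.single (node l m r) 1

theorem nodeLin_single (l m r : TernaryTree) (x y z : K) :
    nodeLin K (Finsupp.single l x) (Finsupp.single m y) (Finsupp.single r z) =
      Finsupp.single (node l m r) (x * y * z) := by
  simp only [nodeLin, Finsupp.linearCombination_single, LinearMap.smul_apply, Finsupp.smul_single,
    smul_eq_mul, mul_one, mul_assoc]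

theorem linearMap_mem {S : Submodule K (TreePoly K)} (L : TreePoly K →ₗ[K] TreePoly K)
    (h : ∀ s, L (Finsupp.single s 1) ∈ S) (f : TreePoly K) : L f ∈ S := by
  induction f using Finsupp.induction_linear with
  | zero => rw [map_zero]; exact zero_mem S
  | add a b ha hb => rw [map_add]; exact add_mem ha hb
  | single s c =>
    rw [← mul_one c, ← smul_eq_mul, ← Finsupp.smul_single, map_smul]
    exact S.smul_mem _ (h s)

theorem nodeLin_trinomial_mem {p q r : TernaryTree} {x y : K} (h : Relation K p q r x y)
    (s t : TernaryTree) :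
    nodeLin K (trinomial p q r x y) (Finsupp.single s 1) (Finsupp.single t 1) ∈ relationSpan K ∧
    nodeLin K (Finsupp.single s 1) (trinomial p q r x y) (Finsupp.single t 1) ∈ relationSpan K ∧
    nodeLin K (Finsupp.single s 1) (Finsupp.single t 1) (trinomial p q r x y) ∈ relationSpan K := by
  simp only [trinomial, map_add, LinearMap.add_apply, nodeLin_single, mul_one, one_mul]
  exact ⟨(h.left s t).mem_relationSpan, (h.mid s t).mem_relationSpan,
    (h.right s t).mem_relationSpan⟩

theorem linearMap_mem_of_mem_relationSpan {S : Submodule K (TreePoly K)}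
    (L : TreePoly K →ₗ[K] TreePoly K)
    (h : ∀ p q r x y, Relation K p q r x y → L (trinomial p q r x y) ∈ S) {f : TreePoly K}
    (hf : f ∈ relationSpan K) : L f ∈ S := by
  have : relationSpan K ≤ S.comap L := by
    refine Submodule.span_le.2 ?_
    rintro _ ⟨p, q, r, x, y, hr, rfl⟩
    exact h p q r x y hr
  exact this hf

theorem nodeLin_left_mem {f : TreePoly K} (hf : f ∈ relationSpan K) (g h : TreePoly K) :
    nodeLin K f g h ∈ relationSpan K := by
  refine linearMap_mem (nodeLin K f g) (fun t => ?_) h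
  refine linearMap_mem ((nodeLin K f).flip (Finsupp.single t 1)) (fun s => ?_) g
  exact linearMap_mem_of_mem_relationSpan
    ((((nodeLin K).flip (Finsupp.single s 1)).flip (Finsupp.single t 1)))
    (fun _ _ _ _ _ hr => (nodeLin_trinomial_mem hr s t).1) hf

theorem nodeLin_mid_mem {f : TreePoly K} (hf : f ∈ relationSpan K) (g h : TreePoly K) :
    nodeLin K g f h ∈ relationSpan K := by
  refine linearMap_mem (nodeLin K g f) (fun t => ?_) h
  refine linearMap_mem (((nodeLin K).flip f).flip (Finsupp.single t 1)) (fun s => ?_) g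
  exact linearMap_mem_of_mem_relationSpan ((nodeLin K (Finsupp.single s 1)).flip (Finsupp.single t 1))
    (fun _ _ _ _ _ hr => (nodeLin_trinomial_mem hr s t).2.1) hf

theorem nodeLin_right_mem {f : TreePoly K} (hf : f ∈ relationSpan K) (g h : TreePoly K) :
    nodeLin K g h f ∈ relationSpan K := by
  refine linearMap_mem ((nodeLin K g).flip f) (fun t => ?_) h
  refine linearMap_mem (((nodeLin K).flip (Finsupp.single t 1)).flip f) (fun s => ?_) g
  exact linearMap_mem_of_mem_relationSpan (nodeLin K (Finsupp.single s 1) (Finsupp.single t 1))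
    (fun _ _ _ _ _ hr => (nodeLin_trinomial_mem hr s t).2.2) hf

theorem ofBin_join (a b : BinPoly K) :
    ofBin K (join K a b) = nodeLin K (Finsupp.single leaf 1) (ofBin K a) (ofBin K b) := by
  induction a using BinPoly.induction_linear with
  | zero => simp
  | add a a' ha hb => simp only [map_add, LinearMap.add_apply, ha, hb]
  | smul c a ha => simp only [map_smul, LinearMap.smul_apply, ha]
  | tree x =>
    induction b using BinPoly.induction_linear with
    | zero => simp
    | add a a' ha hb => simp only [map_add, ha, hb]
    | smul c a ha => simp only [map_smul, ha]
    | tree y => simp [join_of, ofBin_of, nodeLin_single, ofBinary]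

/-- One rewriting step is the instance of the relation whose first subtree is a leaf (`h3`). The two
smaller products that it creates are replaced by their values in the model by induction (`h1`,
`h2`). -/
theorem nodeLin_ofBin_of_sub_mem (x y z : BinaryTree Unit) :
    nodeLin K (ofBin K (of x)) (ofBin K (of y)) (ofBin K (of z)) -
      ofBin K (prod K (of x) (of y) (of z)) ∈ relationSpan K := by
  induction x generalizing y z with
  | nil =>
    rw [prod_nil, ofBin_join, ofBin_of, ofBin, ofBinary, sub_self]
    exact zero_mem _
  | node u x x' hx hx' =>
    have h1 := nodeLin_mid_mem (hx x' y) (Finsupp.single leaf 1) (ofBin K (of z))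
    have h2 := nodeLin_right_mem (hx' y z) (Finsupp.single leaf 1)
      (ofBin K (parity K (of x)))
    have h3 := (Relation.base (K := K) leaf (ofBinary x) (ofBinary x') (ofBinary y)
      (ofBinary z)).mem_relationSpan
    have h := sub_mem (sub_mem h3 h1) h2
    convert h using 1
    rw [← join_of, prod_join]
    simp only [map_sub, map_neg, LinearMap.sub_apply, ofBin_join, trinomial, parity_of, map_smul,
      LinearMap.smul_apply, ofBin_of, nodeLin_single, weight_ofBinary, weight, mul_one, pow_zero,
      zero_add]
    simp only [Finsupp.smul_single, smul_eq_mul, mul_one]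
    abel

theorem nodeLin_ofBin_sub_mem (a b c : BinPoly K) :
    nodeLin K (ofBin K a) (ofBin K b) (ofBin K c) - ofBin K (prod K a b c) ∈ relationSpan K := by
  induction a using BinPoly.induction_linear with
  | zero => simp
  | add a a' h h' =>
    simp only [map_add, LinearMap.add_apply, add_sub_add_comm]
    exact add_mem h h'
  | smul k a h =>
    simp only [map_smul, LinearMap.smul_apply, ← smul_sub]
    exact Submodule.smul_mem _ _ h
  | tree x =>
    induction b using BinPoly.induction_linear with
    | zero => simp
    | add a a' h h' =>
      simp only [map_add, LinearMap.add_apply, add_sub_add_comm]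
      exact add_mem h h'
    | smul k a h =>
      simp only [map_smul, LinearMap.smul_apply, ← smul_sub]
      exact Submodule.smul_mem _ _ h
    | tree y =>
      induction c using BinPoly.induction_linear with
      | zero => simp
      | add a a' h h' =>
        simp only [map_add, add_sub_add_comm]
        exact add_mem h h'
      | smul k a h =>
        simp only [map_smul, ← smul_sub]
        exact Submodule.smul_mem _ _ h
      | tree z => exact nodeLin_ofBin_of_sub_mem x y z

/-- A telescoping sum: the three subtrees are replaced by their normal forms one at a time, then the
outer node is evaluated. -/
theorem single_sub_ofBin_normalFormTree_mem (p : TernaryTree) :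
    Finsupp.single p 1 - ofBin K (normalFormTree K p) ∈ relationSpan K := by
  induction p with
  | leaf =>
    rw [normalFormTree, ofBin_of, ofBinary, sub_self]
    exact zero_mem _
  | node l m r hl hm hr =>
    have h1 := nodeLin_left_mem hl (Finsupp.single m 1) (Finsupp.single r 1)
    have h2 := nodeLin_mid_mem hm (ofBin K (normalFormTree K l)) (Finsupp.single r 1)
    have h3 := nodeLin_right_mem hr (ofBin K (normalFormTree K l)) (ofBin K (normalFormTree K m))
    have h4 := nodeLin_ofBin_sub_mem (normalFormTree K l) (normalFormTree K m) (normalFormTree K r)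
    convert add_mem (add_mem (add_mem h1 h2) h3) h4 using 1
    simp only [map_sub, LinearMap.sub_apply, nodeLin_single, mul_one, normalFormTree]
    abel

theorem ker_normalForm : LinearMap.ker (normalForm K) = relationSpan K := by
  refine le_antisymm (fun f hf => ?_) relationSpan_le_ker
  have := linearMap_mem (LinearMap.id - (ofBin K).comp (normalForm K)) (S := relationSpan K)
    (fun s => by
      simpa [normalForm_single] using single_sub_ofBin_normalFormTree_mem s) f
  simpa [LinearMap.mem_ker.1 hf] using this

theorem normalFormTree_ofBinary (x : BinaryTree Unit) : normalFormTree K (ofBinary x) = of x := by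
  induction x with
  | nil => rfl
  | node u x y hx hy => rw [ofBinary, normalFormTree, hx, hy, normalFormTree, prod_nil, join_of]

/-! ### Triangularity of normal forms for path-lex order -/

/-- The binary trees whose normal tree has the same weight as `p` and does not exceed `p` in
path-lex order. -/
def lowerTrees (p : TernaryTree) : Set (BinaryTree Unit) :=
  {x | x.numNodes = p.weight ∧ (ofBinary x).pathSeq ≤ p.pathSeq}

theorem lowerTrees_node {l m r : TernaryTree} {x y z : BinaryTree Unit} (hx : x ∈ lowerTrees l)
    (hy : y ∈ lowerTrees m) (hz : z ∈ lowerTrees r) :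
    lowerTrees (node (ofBinary x) (ofBinary y) (ofBinary z)) ⊆ lowerTrees (node l m r) := by
  rintro b ⟨h, h'⟩
  have ex : (ofBinary x).weight = l.weight := (weight_ofBinary x).trans hx.1
  have ey : (ofBinary y).weight = m.weight := (weight_ofBinary y).trans hy.1
  have ez : (ofBinary z).weight = r.weight := (weight_ofBinary z).trans hz.1
  refine ⟨by rw [h]; simp only [weight, ex, ey, ez], h'.trans ?_⟩
  rcases hx.2.lt_or_eq with h1 | h1
  · exact (pathSeq_node_lt_left ex h1).le
  rcases hy.2.lt_or_eq with h2 | h2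
  -- Only the path sequences are known to agree, not the trees, so the substitution takes place
  -- inside `pathSeq`.
  · simp only [pathSeq, ← h1]
    exact (pathSeq_node_lt_mid (l := ofBinary x) ey h2).le
  rcases hz.2.lt_or_eq with h3 | h3
  · simp only [pathSeq, ← h1, ← h2]
    exact (pathSeq_node_lt_right (l := ofBinary x) (m := ofBinary y) h3).le
  · simp only [pathSeq, h1, h2, h3, le_refl]

theorem linearMap_mem_of_supported {s : Set (BinaryTree Unit)} {W : Submodule K (BinPoly K)}
    (L : BinPoly K →ₗ[K] BinPoly K) (h : ∀ x ∈ s, L (of x) ∈ W) {f : BinPoly K}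
    (hf : f ∈ Finsupp.supported K K s) : L f ∈ W := by
  have : Finsupp.supported K K s ≤ W.comap L := by
    rw [Finsupp.supported_eq_span_single]
    refine Submodule.span_le.2 ?_
    rintro _ ⟨x, hx, rfl⟩
    exact h x hx
  exact this hf

theorem of_mem_supported {s : Set (BinaryTree Unit)} {x : BinaryTree Unit} (hx : x ∈ s) :
    (of x : BinPoly K) ∈ Finsupp.supported K K s :=
  Finsupp.single_mem_supported K _ hx

theorem join_mem_supported {m r : TernaryTree} {a b : BinPoly K}
    (ha : a ∈ Finsupp.supported K K (lowerTrees m)) (hb : b ∈ Finsupp.supported K K (lowerTrees r)) :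
    join K a b ∈ Finsupp.supported K K (lowerTrees (node leaf m r)) := by
  refine linearMap_mem_of_supported (join K a) (fun y hy => ?_) hb
  refine linearMap_mem_of_supported ((join K).flip (of y)) (fun x hx => ?_) ha
  rw [LinearMap.flip_apply, join_of]
  refine of_mem_supported (lowerTrees_node (x := .nil) ⟨rfl, le_rfl⟩ hx hy ?_)
  exact ⟨by simp [BinaryTree.numNodes, weight, ofBinary, weight_ofBinary], le_rfl⟩

theorem lowerTrees_mono {p q : TernaryTree} (hw : p.weight = q.weight)
    (h : p.pathSeq ≤ q.pathSeq) : lowerTrees p ⊆ lowerTrees q :=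
  fun _ hx => ⟨hx.1.trans hw, hx.2.trans h⟩

theorem mem_lowerTrees_ofBinary (x : BinaryTree Unit) : x ∈ lowerTrees (ofBinary x) :=
  ⟨(weight_ofBinary x).symm, le_rfl⟩

/-- Both terms on the right of the rewriting rule come from trees whose left child is a leaf, hence
from smaller ones; `lowerTrees_mono` carries the inductive bounds up. -/
theorem prod_of_mem_supported (x y z : BinaryTree Unit) :
    prod K (of x) (of y) (of z) ∈
      Finsupp.supported K K (lowerTrees (node (ofBinary x) (ofBinary y) (ofBinary z))) := by
  induction x generalizing y z with
  | nil =>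
    rw [prod_nil]
    exact join_mem_supported (of_mem_supported (mem_lowerTrees_ofBinary y))
      (of_mem_supported (mem_lowerTrees_ofBinary z))
  | node u x x' hx hx' =>
    rw [← join_of, prod_join, parity_of, map_smul, LinearMap.smul_apply]
    have h1 := join_mem_supported (hx x' y) (of_mem_supported (K := K) (mem_lowerTrees_ofBinary z))
    have h2 := join_mem_supported (of_mem_supported (K := K) (mem_lowerTrees_ofBinary x)) (hx' y z)
    refine sub_mem (neg_mem (Finsupp.supported_mono (lowerTrees_mono ?_ ?_) h1))
      (Submodule.smul_mem _ _ (Finsupp.supported_mono (lowerTrees_mono ?_ ?_) h2))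
    · simp only [ofBinary, weight]; omega
    · exact (pathSeq_node_lt_node_node ..).le
    · simp only [ofBinary, weight]; omega
    · exact (pathSeq_node_lt_node_node ..).le

theorem normalFormTree_mem_supported (p : TernaryTree) :
    normalFormTree K p ∈ Finsupp.supported K K (lowerTrees p) := by
  induction p with
  | leaf => exact of_mem_supported ⟨rfl, le_rfl⟩
  | node l m r hl hm hr =>
    rw [normalFormTree]
    refine linearMap_mem_of_supported
      (prod K (normalFormTree K l) (normalFormTree K m)) (fun z hz => ?_) hr
    refine linearMap_mem_of_supported
      ((prod K (normalFormTree K l)).flip (of z)) (fun y hy => ?_) hm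
    refine linearMap_mem_of_supported
      (((prod K).flip (of y)).flip (of z)) (fun x hx => ?_) hl
    exact Finsupp.supported_mono (lowerTrees_node hx hy hz) (prod_of_mem_supported x y z)

/-! ### Normal monomials and the dimension -/

theorem isNormal_iff (p : TernaryTree) : IsNormal K p ↔ p.NoLeftInternal := by
  refine ⟨fun h => ?_, fun h f hf hlead => ?_⟩
  · by_contra hp
    obtain ⟨q, r, x, y, hr⟩ := exists_relation (K := K) hp
    exact h _ ⟨paIdeal_eq (K := K) ▸ hr.mem_relationSpan, hr.trinomial_mem_ofArity⟩
      hr.isLeadingMonomial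
  · obtain ⟨x, rfl⟩ := exists_ofBinary h
    have h0 : normalForm K f = 0 := by
      rw [← LinearMap.mem_ker, ker_normalForm, ← paIdeal_eq]
      exact hf.1
    -- Compare coefficients at `x`. The other trees in `f` are smaller than `ofBinary x`, so `x` is
    -- absent from their normal forms, and the coefficient of the leading tree would have to vanish.
    have h1 := DFunLike.congr_fun h0 x
    rw [normalForm, Finsupp.linearCombination_apply, Finsupp.sum, Finsupp.finsetSum_apply,
      Finset.sum_eq_single_of_mem _ hlead.1] at h1
    · rw [normalFormTree_ofBinary] at h1
      have := Finsupp.mem_support_iff.1 hlead.1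
      simp [of, this] at h1
    · intro q hq hqx
      have : x ∉ (normalFormTree K q).support := fun hx =>
        absurd ((normalFormTree_mem_supported (K := K) q) hx).2 (hlead.2 q hq hqx).not_ge
      rw [Finsupp.smul_apply, Finsupp.notMem_support_iff.1 this, smul_zero]

/-- Evaluation preserves weight, and each binary tree is the value of its own normal tree; this is
the graded form of surjectivity needed for the dimension count. -/
theorem map_normalForm_supported (w : ℕ) :
    (Finsupp.supported K K {p : TernaryTree | p.weight = w}).map (normalForm K) =
      Finsupp.supported K K {x : BinaryTree Unit | x.numNodes = w} := by
  refine le_antisymm ?_ ?_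
  · rw [Finsupp.supported_eq_span_single, Submodule.map_span_le]
    rintro _ ⟨p, hp, rfl⟩
    rw [normalForm_single, one_smul]
    exact Finsupp.supported_mono (fun x hx => hx.1.trans hp) (normalFormTree_mem_supported p)
  · rw [Finsupp.supported_eq_span_single K {x : BinaryTree Unit | x.numNodes = w},
      Submodule.span_le]
    rintro _ ⟨x, hx, rfl⟩
    refine ⟨Finsupp.single (ofBinary x) 1, Finsupp.single_mem_supported K _
      ((weight_ofBinary x).trans hx), ?_⟩
    rw [normalForm_single, one_smul, normalFormTree_ofBinary, of]

variable (K) in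
/-- The map from the odd partially associative operad to the model that takes normal forms. -/
noncomputable def quotientToBin : OddTPA K →ₗ[K] BinPoly K :=
  (paIdeal K).liftQ (normalForm K) (by rw [ker_normalForm, paIdeal_eq])

theorem quotientToBin_injective : Function.Injective (quotientToBin K) := by
  rw [← LinearMap.ker_eq_bot, quotientToBin]
  exact Submodule.ker_liftQ_eq_bot _ _ _ (by rw [ker_normalForm, paIdeal_eq])

theorem rank_ofWeight (w : ℕ) : Module.rank K (OddTPA.ofWeight K w) = (catalan w : Cardinal) := by
  have e := Submodule.equivMapOfInjective (quotientToBin K) quotientToBin_injective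
    (OddTPA.ofWeight K w)
  have h : (OddTPA.ofWeight K w).map (quotientToBin K) =
      Finsupp.supported K K (BinaryTree.treesOfNumNodesEq w : Set (BinaryTree Unit)) := by
    rw [OddTPA.ofWeight, ← Submodule.map_comp, quotientToBin, Submodule.liftQ_mkQ,
      map_normalForm_supported, BinaryTree.coe_treesOfNumNodesEq]
  rw [h] at e
  have e' := e.trans (Finsupp.supportedEquivFinsupp _)
  rw [e'.rank_eq, rank_finsupp_self, ← BinaryTree.treesOfNumNodesEq_card_eq_catalan]
  simp only [SetLike.coe_sort_coe, Cardinal.mk_coe_finset, Cardinal.lift_natCast]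

end TreePoly

theorem theorem3p12 (K : Type*) [Field K] [CharZero K] (w : ℕ) :
    Module.rank K (TreePoly.OddTPA.ofWeight K w) = (catalan w : Cardinal) ∧
      ∀ p : TernaryTree, p.weight = w → (TreePoly.IsNormal K p ↔ p.NoLeftInternal) :=
  ⟨TreePoly.rank_ofWeight w, fun p _ => TreePoly.isNormal_iff p⟩
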